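/- All algebras are complex associative algebras, not necessarily with unit, and isomorphism means isomorphism of such algebras. For an algebra $\mathcal{A}$ put $\mathcal{A}^1=\mathcal{A}$ and $\mathcal{A}^{i+1}=\sum_{k=1}^{i}\mathcal{A}^k\mathcal{A}^{i+1-k}$ for $i\ge 1$; $\mathcal{A}$ is nilpotent if $\mathcal{A}^i=0$ for some $i$. A nilpotent algebra $\mathcal{A}$ is naturally graded if it is isomorphic to its associated graded algebra $\operatorname{gr}\mathcal{A}=\bigoplus_{i\ge1}\mathcal{A}^i/\mathcal{A}^{i+1}$ (with the induced multiplication). For $x\in\mathcal{A}\setminus\mathcal{A}^2$ let $C(x)$ be the decreasing sequence of the sizes of the Jordan blocks of the nilpotent operator $L_x\colon z\mapsto xz$; the characteristic sequence of $\mathcal{A}$ is $C(\mathcal{A})=\max_{x\in\mathcal{A}\setminus\mathcal{A}^2}C(x)$ for the lexicographic order. **Theorem.** Let $n>5$, and let $\mathcal{A}$ be an $n$-dimensional complex naturally graded associative algebra with characteristic sequence $C(\mathcal{A})=(n-2,2)$. Then $\mathcal{A}$ is isomorphic to one of the following algebras, given on a basis $e_1,\dots,e_n$ (omitted products are zero):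 - $\mu_{2,2}^n(\alpha)$, $\alpha\in\mathbb{C}$: $e_ie_j=e_{i+j}$ for $2\le i+j\le n-2$, $\ e_1e_{n-1}=e_n$, $\ e_{n-1}e_1=\alpha e_n$; - $\mu_{2,3}^n$: $e_ie_j=e_{i+j}$ for $2\le i+j\le n-2$, $\ e_1e_{n-1}=e_n$, $\ e_{n-1}e_1=e_n$, $\ e_{n-1}e_{n-1}=e_n$; - $\mu_{2,4}^n$: $e_ie_j=e_{i+j}$ for $2\le i+j\le n-2$, $\ e_1e_{n-1}=e_n$, $\ e_{n-1}e_{n-1}=e_n$. These algebras are pairwise non-isomorphic; in particular $\mu_{2,2}^n(\alpha)\not\cong\mu_{2,2}^n(\beta)$ for $\alpha\ne\beta$. -/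

import Mathlib

open scoped DirectSum

noncomputable section

namespace NilAssoc

section Series

variable (A : Type*) [NonUnitalRing A] [Module ℂ A] [IsScalarTower ℂ A A] [SMulCommClass ℂ A A]

/-- The series `A^1 = A`, `A^(m+1) = ∑_{k=1}^{m} A^k A^(m+1-k)`, where the product of two
subspaces is the linear span of the products of their elements. (The value at `0` is a
placeholder that is never used.) -/
def power : ℕ → Submodule ℂ A
  | 0 => ⊤
  | 1 => ⊤
  | m + 2 => ⨆ k : Fin (m + 1),
      Submodule.map₂ (LinearMap.mul ℂ A) (power (k + 1)) (power (m + 1 - k))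
  termination_by m => m

/-- `A` is nilpotent if `A^m = 0` for some `m ≥ 1`. -/
def IsNilpotentAlg : Prop := ∃ m : ℕ, 1 ≤ m ∧ power A m = ⊥

theorem mul_mem_power {i j : ℕ} (hi : 1 ≤ i) (hj : 1 ≤ j) {x y : A}
    (hx : x ∈ power A i) (hy : y ∈ power A j) : x * y ∈ power A (i + j) := by
  obtain ⟨a, rfl⟩ := Nat.exists_eq_add_of_le' hi
  obtain ⟨b, rfl⟩ := Nat.exists_eq_add_of_le' hj
  have h : a + 1 + (b + 1) = (a + b) + 2 := by omega
  rw [h, power]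
  refine Submodule.mem_iSup_of_mem (⟨a, by omega⟩ : Fin (a + b + 1)) ?_
  have h2 : a + b + 1 - a = b + 1 := by omega
  simp only [h2]
  exact Submodule.apply_mem_map₂ (LinearMap.mul ℂ A) hx hy

/-- The homogeneous component `A_i = A^i / A^(i+1)`, for `i ≥ 1`. -/
abbrev grPiece (i : ℕ+) : Type _ :=
  power A i ⧸ (power A ((i : ℕ) + 1)).submoduleOf (power A i)

/-- The class in `A_i` of an element of `A^i`. -/
abbrev grMk (i : ℕ+) : power A i →ₗ[ℂ] grPiece A i := Submodule.mkQ _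

/-- The product `A^i × A^j → A_(i+j)`. -/
def grMulPre (i j : ℕ+) : power A i →ₗ[ℂ] power A j →ₗ[ℂ] grPiece A (i + j) :=
  LinearMap.mk₂ ℂ
    (fun x y => grMk A (i + j) ⟨(x : A) * y, mul_mem_power A i.2 j.2 x.2 y.2⟩)
    (fun x x' y => by
      rw [← map_add]; congr 1; exact Subtype.ext (add_mul _ _ _))
    (fun c x y => by
      rw [← map_smul]; congr 1; exact Subtype.ext (smul_mul_assoc _ _ _))
    (fun x y y' => by
      rw [← map_add]; congr 1; exact Subtype.ext (mul_add _ _ _))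
    (fun c x y => by
      rw [← map_smul]; congr 1; exact Subtype.ext (mul_smul_comm _ _ _))

/-- The product `A_i × A_j → A_(i+j)` induced by the multiplication of `A`. -/
def grMul (i j : ℕ+) : grPiece A i →ₗ[ℂ] grPiece A j →ₗ[ℂ] grPiece A (i + j) :=
  Submodule.liftQ _
    (LinearMap.flip (Submodule.liftQ _ (grMulPre A i j).flip (by
      intro y hy
      rw [LinearMap.mem_ker]
      ext x
      have hy' : (y : A) ∈ power A ((j : ℕ) + 1) := hy
      refine (Submodule.Quotient.mk_eq_zero _).2 ?_
      exact mul_mem_power A i.2 (Nat.le_add_left 1 j) x.2 hy')))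
    (by
      intro x hx
      rw [LinearMap.mem_ker]
      ext y
      have hx' : (x : A) ∈ power A ((i : ℕ) + 1) := hx
      refine (Submodule.Quotient.mk_eq_zero _).2 ?_
      have h := mul_mem_power A (Nat.le_add_left 1 i) j.2 hx' y.2
      have e : (i : ℕ) + 1 + j = (i + j : ℕ+) + 1 := by rw [PNat.add_coe]; omega
      exact e ▸ h)

theorem grMul_mk (i j : ℕ+) (x : power A i) (y : power A j) :
    grMul A i j (grMk A i x) (grMk A j y) =
      grMk A (i + j) ⟨(x : A) * y, mul_mem_power A i.2 j.2 x.2 y.2⟩ := rfl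

instance : DirectSum.GNonUnitalNonAssocSemiring (grPiece A) where
  mul {i j} a b := grMul A i j a b
  mul_zero _ := map_zero _
  zero_mul _ := LinearMap.map_zero₂ _ _
  mul_add _ _ _ := map_add _ _ _
  add_mul _ _ _ := LinearMap.map_add₂ _ _ _ _

/-- The associated graded algebra `gr A = A_1 ⊕ A_2 ⊕ ⋯`. -/
abbrev Gr : Type _ := ⨁ i : ℕ+, grPiece A i

end Series

/-- Isomorphism of (not necessarily unital) complex algebras. -/
def AlgIso (A B : Type*) [NonUnitalNonAssocSemiring A] [Module ℂ A]
    [NonUnitalNonAssocSemiring B] [Module ℂ B] : Prop :=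
  ∃ f : A →ₙₐ[ℂ] B, Function.Bijective f

/-- A nilpotent associative algebra is naturally graded if it is isomorphic to `gr A`. -/
def IsNaturallyGraded (A : Type*) [NonUnitalRing A] [Module ℂ A] [IsScalarTower ℂ A A]
    [SMulCommClass ℂ A A] : Prop :=
  IsNilpotentAlg A ∧ AlgIso (Gr A) A

/-- `s = (s_0, s_1, …)` is the decreasing sequence of the sizes of the Jordan blocks of the
nilpotent operator `f`: there is a basis made of chains
`b_{k,0} ↦ b_{k,1} ↦ ⋯ ↦ b_{k,s_k - 1} ↦ 0`. -/
def HasJordanSizes {V : Type*} [AddCommGroup V] [Module ℂ V] (f : V →ₗ[ℂ] V) (s : List ℕ) : Prop :=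
  s.Pairwise (· ≥ ·) ∧ (∀ m ∈ s, 1 ≤ m) ∧
    ∃ b : Module.Basis (Σ k : Fin s.length, Fin (s.get k)) ℂ V,
      ∀ (k : Fin s.length) (i : Fin (s.get k)),
        f (b ⟨k, i⟩) = if h : (i : ℕ) + 1 < s.get k then b ⟨k, ⟨i + 1, h⟩⟩ else 0

/-- The characteristic sequence of `A` is `s`: it is the lexicographic maximum of the sequences of
Jordan block sizes of the left multiplications by the elements of `A ∖ A^2`. -/
def HasCharacteristicSequence (A : Type*) [NonUnitalRing A] [Module ℂ A] [IsScalarTower ℂ A A]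
    [SMulCommClass ℂ A A] (s : List ℕ) : Prop :=
  IsGreatest {t : List ℕ | ∃ x : A, x ∉ power A 2 ∧ HasJordanSizes (LinearMap.mulLeft ℂ x) t} s

/-- The coordinate space of the algebra with basis `e_1, …, e_n` and multiplication table
`e_i e_j = e_(i+j)` for `2 ≤ i + j ≤ n - 2`, `e_1 e_(n-1) = e_n`, `e_(n-1) e_1 = a e_n`,
`e_(n-1) e_(n-1) = b e_n`, the omitted products being zero. -/
def Mu (n : ℕ) (_a _b : ℂ) : Type := Fin n → ℂ

namespace Mu

variable {n : ℕ} {a b : ℂ}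

instance : AddCommGroup (Mu n a b) := inferInstanceAs (AddCommGroup (Fin n → ℂ))

instance : Module ℂ (Mu n a b) := inferInstanceAs (Module ℂ (Fin n → ℂ))

/-- The basis `e_1, …, e_n`; the vector `e_(i+1)` has index `i : Fin n`. -/
def basis (n : ℕ) (a b : ℂ) : Module.Basis (Fin n) ℂ (Mu n a b) := Pi.basisFun ℂ (Fin n)

/-- The vector `e_i`, for `1 ≤ i ≤ n` (and zero for all other `i`). -/
def e (n : ℕ) (a b : ℂ) (i : ℕ) : Mu n a b :=
  if h : 1 ≤ i ∧ i ≤ n then basis n a b ⟨i - 1, by omega⟩ else 0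

/-- The product `e_i e_j` prescribed by the multiplication table, for `1 ≤ i, j ≤ n`. -/
def table (n : ℕ) (a b : ℂ) (i j : ℕ) : Mu n a b :=
  if i + j + 2 ≤ n then e n a b (i + j)
  else if i = 1 ∧ j + 1 = n then e n a b n
  else if i + 1 = n ∧ j = 1 then a • e n a b n
  else if i + 1 = n ∧ j + 1 = n then b • e n a b n
  else 0

/-- The bilinear multiplication given by the table. -/
def mulBilin (n : ℕ) (a b : ℂ) : Mu n a b →ₗ[ℂ] Mu n a b →ₗ[ℂ] Mu n a b :=
  (basis n a b).constr ℂ fun i => (basis n a b).constr ℂ fun j => table n a b (i + 1) (j + 1)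

instance : Mul (Mu n a b) := ⟨fun x y => mulBilin n a b x y⟩

theorem mul_def (x y : Mu n a b) : x * y = mulBilin n a b x y := rfl

theorem basis_mul_basis (i j : Fin n) :
    basis n a b i * basis n a b j = table n a b (i + 1) (j + 1) := by
  simp [mul_def, mulBilin]

theorem e_mul_e {i j : ℕ} (hi : 1 ≤ i) (hi' : i ≤ n) (hj : 1 ≤ j) (hj' : j ≤ n) :
    e n a b i * e n a b j = table n a b i j := by
  rw [e, e, dif_pos ⟨hi, hi'⟩, dif_pos ⟨hj, hj'⟩, basis_mul_basis]
  simp [Nat.sub_add_cancel hi, Nat.sub_add_cancel hj]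

instance : NonUnitalNonAssocRing (Mu n a b) where
  left_distrib x y z := map_add (mulBilin n a b x) y z
  right_distrib x y z := LinearMap.map_add₂ (mulBilin n a b) x y z
  zero_mul x := LinearMap.map_zero₂ (mulBilin n a b) x
  mul_zero x := map_zero (mulBilin n a b x)

instance : IsScalarTower ℂ (Mu n a b) (Mu n a b) where
  smul_assoc c x y := LinearMap.map_smul₂ (mulBilin n a b) c x y

instance : SMulCommClass ℂ (Mu n a b) (Mu n a b) where
  smul_comm c x y := (map_smul (mulBilin n a b x) c y).symm

theorem table_mul_e {i j k : ℕ} (hi : 1 ≤ i) (hj : 1 ≤ j) (hk : 1 ≤ k) (hk' : k ≤ n) :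
    table n a b i j * e n a b k = if i + j + k + 2 ≤ n then e n a b (i + j + k) else 0 := by
  have hn : e n a b n * e n a b k = 0 := by
    rw [e_mul_e (hk.trans hk') le_rfl hk hk', table, if_neg (by omega), if_neg (by omega),
      if_neg (by omega), if_neg (by omega)]
  rw [table]
  split_ifs with h1 h2 h3 h4 h5 h6 h7
  · rw [e_mul_e (by omega) (by omega) hk hk', table, if_pos h2]
  · rw [e_mul_e (by omega) (by omega) hk hk', table, if_neg h2, if_neg (by omega),
      if_neg (by omega), if_neg (by omega)]
  all_goals first
    | omega
    | simp [hn, smul_mul_assoc]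

theorem e_mul_table {i j k : ℕ} (hi : 1 ≤ i) (hi' : i ≤ n) (hj : 1 ≤ j) (hk : 1 ≤ k) :
    e n a b i * table n a b j k = if i + j + k + 2 ≤ n then e n a b (i + j + k) else 0 := by
  have hn : e n a b i * e n a b n = 0 := by
    rw [e_mul_e hi hi' (hi.trans hi') le_rfl, table, if_neg (by omega), if_neg (by omega),
      if_neg (by omega), if_neg (by omega)]
  rw [table]
  split_ifs with h1 h2 h3 h4 h5 h6 h7
  · rw [e_mul_e hi hi' (by omega) (by omega), table, if_pos (by omega), add_assoc]
  · rw [e_mul_e hi hi' (by omega) (by omega), table, if_neg (by omega), if_neg (by omega),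
      if_neg (by omega), if_neg (by omega)]
  all_goals first
    | omega
    | simp [hn, mul_smul_comm]

theorem basis_eq_e (i : Fin n) : basis n a b i = e n a b (i + 1) := by
  rw [e, dif_pos ⟨by omega, by omega⟩]
  rfl

theorem basis_mul_assoc (i j k : Fin n) :
    basis n a b i * basis n a b j * basis n a b k =
      basis n a b i * (basis n a b j * basis n a b k) := by
  rw [basis_mul_basis, basis_mul_basis, basis_eq_e i, basis_eq_e k,
    table_mul_e (by omega) (by omega) (by omega) (by omega),
    e_mul_table (by omega) (by omega) (by omega) (by omega)]

instance : NonUnitalRing (Mu n a b) where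
  mul_assoc x y z := by
    rw [← (basis n a b).sum_repr x, ← (basis n a b).sum_repr y, ← (basis n a b).sum_repr z]
    simp only [Finset.sum_mul, Finset.mul_sum, smul_mul_assoc, mul_smul_comm, basis_mul_assoc]

end Mu

/-- `μ_{2,2}^n(α)`: `e_i e_j = e_(i+j)` for `2 ≤ i + j ≤ n - 2`, `e_1 e_(n-1) = e_n`,
`e_(n-1) e_1 = α e_n`. -/
abbrev Mu22 (n : ℕ) (α : ℂ) : Type := Mu n α 0

/-- `μ_{2,3}^n`: `e_i e_j = e_(i+j)` for `2 ≤ i + j ≤ n - 2`,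
`e_1 e_(n-1) = e_(n-1) e_1 = e_(n-1) e_(n-1) = e_n`. -/
abbrev Mu23 (n : ℕ) : Type := Mu n 1 1

/-- `μ_{2,4}^n`: `e_i e_j = e_(i+j)` for `2 ≤ i + j ≤ n - 2`,
`e_1 e_(n-1) = e_(n-1) e_(n-1) = e_n`. -/
abbrev Mu24 (n : ℕ) : Type := Mu n 0 1

end NilAssoc

end

/-! Choose x outside A² such that L_x has Jordan blocks n-2 and 2. Then xA has codimension two, and
A² = xA: otherwise A/A² is spanned by the class of x, and a nilpotent algebra with one generator x
satisfies A² = xA anyway. Hence A^(m+1) = x^m A (`power_eq_range_pow`) and A^(n-1) = 0.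

The grading allows x and the top v of the short chain to be replaced by their degree-one components
X and U. These generate A, X²U = 0, and X⁴ ≠ 0 because n > 5 makes the long block have length at
least 4. Degree two is spanned by X² and XU; left multiplication by X² shows that UX and UU have no
X² term, so UX = a·XU and UU = b·XU (`exists_relations`). These relations give a surjection from `Mu
n a b`, bijective by dimension (`algIso_mu_of_relations`), and a linear change of X and U normalises
(a, b) (`algIso_of_relations`).

Two models are told apart by comparing e_n-coefficients of the images of the defining relations
(`Mu.AlgIso.exists_params`). -/

namespace NilAssoc

/-! ### Powers of an associative algebra. -/

section Power

variable {A : Type*} [NonUnitalRing A] [Module ℂ A] [IsScalarTower ℂ A A] [SMulCommClass ℂ A A]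

theorem power_one : power A 1 = ⊤ := by rw [power]

/-- Associativity moves all brackets to the right: by induction the left factor of A^(k+2)·A^(m-k)
is a sum of products pq with q ∈ A^(k+1), and (pq)b = p(qb). -/
theorem power_add_two (m : ℕ) :
    power A (m + 2) = Submodule.map₂ (LinearMap.mul ℂ A) ⊤ (power A (m + 1)) := by
  induction m using Nat.strong_induction_on with
  | _ m ih =>
    apply le_antisymm
    · rw [power]
      refine iSup_le fun ⟨k, hk⟩ => Submodule.map₂_le.2 fun a ha b hb => ?_
      rcases k with _ | k
      · exact Submodule.apply_mem_map₂ _ trivial hb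
      · have hb' : b ∈ power A (m - k) := by
          have e : m + 1 - (k + 1) = m - k := by omega
          rwa [← e]
        have ha' : a ∈ power A (k + 2) := ha
        rw [ih k (by omega)] at ha'
        suffices Submodule.map₂ (LinearMap.mul ℂ A) ⊤ (power A (k + 1)) ≤
            (Submodule.map₂ (LinearMap.mul ℂ A) ⊤ (power A (m + 1))).comap
              (LinearMap.mulRight ℂ b) from this ha'
        refine Submodule.map₂_le.2 fun p _ q hq => ?_
        simp only [Submodule.mem_comap, LinearMap.mul_apply', LinearMap.mulRight_apply, mul_assoc]
        refine Submodule.apply_mem_map₂ (LinearMap.mul ℂ A) (m := p) trivial ?_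
        have := mul_mem_power A (by omega) (by omega) hq hb'
        have e : k + 1 + (m - k) = m + 1 := by omega
        rwa [e] at this
    · refine Submodule.map₂_le.2 fun a _ b hb => ?_
      have := mul_mem_power A (i := 1) (j := m + 1) le_rfl (by omega)
        (by rw [power_one]; trivial : a ∈ power A 1) hb
      have e : 1 + (m + 1) = m + 2 := by omega
      rwa [e] at this

theorem mul_mem_power_two (a b : A) : a * b ∈ power A 2 :=
  mul_mem_power A (i := 1) (j := 1) le_rfl le_rfl (by rw [power_one]; trivial)
    (by rw [power_one]; trivial)

/-- Induction on products for elements of `A^(m+2) = A * A^(m+1)`. -/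
theorem power_add_two_le {m : ℕ} {S : Submodule ℂ A}
    (h : ∀ a b : A, b ∈ power A (m + 1) → a * b ∈ S) : power A (m + 2) ≤ S := by
  rw [power_add_two]
  exact Submodule.map₂_le.2 fun a _ b hb => h a b hb

theorem power_antitone_succ (m : ℕ) : power A (m + 2) ≤ power A (m + 1) := by
  induction m with
  | zero => rw [power_one]; exact le_top
  | succ m ih =>
    refine power_add_two_le fun a b hb => ?_
    rw [power_add_two]
    exact Submodule.apply_mem_map₂ (LinearMap.mul ℂ A) trivial (ih hb)

theorem power_antitone {i j : ℕ} (hi : 1 ≤ i) (hij : i ≤ j) : power A j ≤ power A i := by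
  induction j, hij using Nat.le_induction with
  | base => exact le_rfl
  | succ j hj ih =>
    obtain ⟨k, rfl⟩ := Nat.exists_eq_add_of_le' (hi.trans hj)
    exact (power_antitone_succ k).trans ih

/-- The point is a(xc) = (ax)c = (xd)c = x(dc), where ax ∈ A² = xA supplies d. -/
theorem power_add_two_eq_map {x : A} (hx : power A 2 = LinearMap.range (LinearMap.mulLeft ℂ x))
    (m : ℕ) : power A (m + 2) = (power A (m + 1)).map (LinearMap.mulLeft ℂ x) := by
  induction m with
  | zero => rw [hx, power_one, Submodule.map_top]
  | succ m ih =>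
    apply le_antisymm
    · refine power_add_two_le fun a b hb => ?_
      rw [ih] at hb
      obtain ⟨c, hc, rfl⟩ := hb
      obtain ⟨d, hd⟩ : a * x ∈ LinearMap.range (LinearMap.mulLeft ℂ x) :=
        hx ▸ mul_mem_power_two a x
      refine ⟨d * c, ?_, ?_⟩
      · rw [power_add_two]
        exact Submodule.apply_mem_map₂ (LinearMap.mul ℂ A) (m := d) trivial hc
      · simp only [LinearMap.mulLeft_apply] at hd ⊢
        rw [← mul_assoc, ← mul_assoc, hd]
    · rw [Submodule.map_le_iff_le_comap]
      intro b hb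
      rw [power_add_two]
      exact Submodule.apply_mem_map₂ (LinearMap.mul ℂ A) (m := x) trivial hb

theorem power_eq_range_pow {x : A} (hx : power A 2 = LinearMap.range (LinearMap.mulLeft ℂ x))
    (m : ℕ) : power A (m + 1) = LinearMap.range (LinearMap.mulLeft ℂ x ^ m) := by
  induction m with
  | zero => rw [power_one, pow_zero]; exact LinearMap.range_id.symm
  | succ m ih =>
    rw [power_add_two_eq_map hx, ih, pow_succ', Module.End.mul_eq_comp, LinearMap.range_comp]

/-- A nilpotent algebra with one generator `x` satisfies `A^2 = xA`. -/
theorem power_two_eq_range_of_span_singleton (hA : IsNilpotentAlg A) {x : A}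
    (hx : ℂ ∙ x ⊔ power A 2 = ⊤) : power A 2 = LinearMap.range (LinearMap.mulLeft ℂ x) := by
  have dec : ∀ p : A, ∃ c : ℂ, ∃ q ∈ power A 2, p = c • x + q := fun p => by
    obtain ⟨y, hy, q, hq, rfl⟩ := Submodule.mem_sup.1 (hx ▸ Submodule.mem_top : p ∈ _)
    obtain ⟨c, rfl⟩ := Submodule.mem_span_singleton.1 hy
    exact ⟨c, q, hq, rfl⟩
  -- Descending induction on the power containing p. Write the leftmost factor of p as cx + r with r
  -- ∈ A²: the x term lies in xA, and the r term starts in a deeper power.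
  have step : ∀ m, (∀ p ∈ power A (m + 2), ∀ q : A,
      p * q ∈ LinearMap.range (LinearMap.mulLeft ℂ x)) → ∀ p ∈ power A (m + 1), ∀ q : A,
      p * q ∈ LinearMap.range (LinearMap.mulLeft ℂ x) := by
    intro m h p hp q
    rcases m with _ | m
    · obtain ⟨c, r, hr, rfl⟩ := dec p
      rw [add_mul]
      exact add_mem ⟨c • q, by simp [smul_mul_assoc]⟩ (h r hr q)
    · suffices power A (m + 2) ≤ (LinearMap.range (LinearMap.mulLeft ℂ x)).comap
        (LinearMap.mulRight ℂ q) from this hp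
      refine power_add_two_le fun a b hb => ?_
      obtain ⟨c, r, hr, rfl⟩ := dec a
      rw [Submodule.mem_comap, LinearMap.mulRight_apply, add_mul, add_mul]
      refine add_mem ⟨c • (b * q), by simp [mul_assoc, smul_mul_assoc]⟩ (h _ ?_ q)
      have := mul_mem_power A (by omega) (by omega) hr hb
      have e : 2 + (m + 1) = m + 1 + 2 := by omega
      rwa [e] at this
  obtain ⟨N, hN, h0⟩ := hA
  obtain ⟨k, rfl⟩ := Nat.exists_eq_add_of_le' hN
  have all : ∀ p ∈ power A 1, ∀ q : A, p * q ∈ LinearMap.range (LinearMap.mulLeft ℂ x) := by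
    have base : ∀ p ∈ power A (k + 1), ∀ q : A,
        p * q ∈ LinearMap.range (LinearMap.mulLeft ℂ x) := fun p hp q => by
      rw [h0, Submodule.mem_bot] at hp
      simp [hp]
    clear h0 hN
    induction k with
    | zero => exact base
    | succ k ih => exact ih (step k base)
  apply le_antisymm
  · exact power_add_two_le fun a b _ => all a (by rw [power_one]; trivial) b
  · rintro _ ⟨b, rfl⟩
    exact mul_mem_power_two x b

/-- If an algebra is generated by `X` and `U` modulo `A^2` and some power vanishes, every subspace
that contains `X` and `U` and is closed under multiplication is the whole algebra. -/
theorem eq_top_of_mul_mem {N : ℕ} (h0 : power A (N + 1) = ⊥) {G T : Submodule ℂ A}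
    (hG : G ⊔ power A 2 = ⊤) (hGT : G ≤ T) (hT : ∀ a ∈ T, ∀ b ∈ T, a * b ∈ T) : T = ⊤ := by
  have key : ∀ m, T ⊔ power A (m + 1) = ⊤ := by
    intro m
    induction m with
    | zero => rw [power_one, sup_top_eq]
    | succ m ih =>
      rw [eq_top_iff, ← hG]
      refine sup_le (hGT.trans le_sup_left) (power_add_two_le fun a b _ => ?_)
      obtain ⟨t, ht, p, hp, rfl⟩ := Submodule.mem_sup.1 (ih ▸ Submodule.mem_top : a ∈ _)
      obtain ⟨s, hs, q, hq, rfl⟩ := Submodule.mem_sup.1 (ih ▸ Submodule.mem_top : b ∈ _)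
      -- With p, q ∈ A^(m+1), every term except ts lies in A^(m+2).
      have e : (t + p) * (s + q) = t * s + (t * q + (p * s + p * q)) := by noncomm_ring
      rw [e]
      have one : ∀ c : A, c ∈ power A 1 := fun c => by rw [power_one]; trivial
      have hl : ∀ c, c * q ∈ power A (m + 2) := fun c => by
        have := mul_mem_power A le_rfl (by omega) (one c) hq
        rwa [show 1 + (m + 1) = m + 2 by omega] at this
      have hr : ∀ c, p * c ∈ power A (m + 2) := fun c =>
        mul_mem_power A (by omega) le_rfl hp (one c)
      exact Submodule.add_mem_sup (hT t ht s hs) (add_mem (hl t) (add_mem (hr s) (hr q)))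
  simpa [h0] using key N

end Power

/-! ### Jordan chains of type (n-2, 2). -/

section Jordan

variable {V : Type*} [AddCommGroup V] [Module ℂ V] {f : V →ₗ[ℂ] V} {s : List ℕ}

theorem pow_apply_chain {b : Module.Basis (Σ k : Fin s.length, Fin (s.get k)) ℂ V}
    (hb : ∀ (k : Fin s.length) (i : Fin (s.get k)),
      f (b ⟨k, i⟩) = if h : (i : ℕ) + 1 < s.get k then b ⟨k, ⟨i + 1, h⟩⟩ else 0)
    (m : ℕ) (k : Fin s.length) (i : Fin (s.get k)) :
    (f ^ m) (b ⟨k, i⟩) = if h : (i : ℕ) + m < s.get k then b ⟨k, ⟨i + m, h⟩⟩ else 0 := by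
  induction m with
  | zero => simp
  | succ m ih =>
    rw [pow_succ', Module.End.mul_apply, ih]
    by_cases h : (i : ℕ) + m < s.get k
    · rw [dif_pos h, hb]
      rfl
    · rw [dif_neg h, map_zero, dif_neg (by omega)]

/-- What is used of a Jordan basis with two blocks of sizes `n - 2` and `2`. -/
theorem HasJordanSizes.exists_generators {n : ℕ} (hn : 5 < n) (h : HasJordanSizes f [n - 2, 2]) :
    ∃ w v : V, Submodule.span ℂ {w, v} ⊔ LinearMap.range f = ⊤ ∧ (f ^ 2) v = 0 ∧
      (f ^ 3) w ∉ LinearMap.range (f ^ 4) ∧ f ^ (n - 2) = 0 := by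
  obtain ⟨-, -, b, hb⟩ := h
  have hp := pow_apply_chain hb
  let z0 : Fin [n - 2, 2].length := ⟨0, by simp⟩
  let z1 : Fin [n - 2, 2].length := ⟨1, by simp⟩
  have g0 : [n - 2, 2].get z0 = n - 2 := rfl
  have g1 : [n - 2, 2].get z1 = 2 := rfl
  have hz : ∀ k : Fin [n - 2, 2].length, k = z0 ∨ k = z1 := by
    rintro ⟨k, hk⟩
    simp only [List.length_cons, List.length_nil] at hk
    rcases k with _ | _ | k
    · exact Or.inl rfl
    · exact Or.inr rfl
    · omega
  refine ⟨b ⟨z0, ⟨0, by omega⟩⟩, b ⟨z1, ⟨0, by omega⟩⟩, ?_, ?_, ?_, ?_⟩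
  · rw [eq_top_iff, ← b.span_eq, Submodule.span_le]
    rintro _ ⟨⟨k, ⟨_ | i, hi⟩⟩, rfl⟩
    · refine Submodule.mem_sup_left (Submodule.subset_span ?_)
      rcases hz k with rfl | rfl
      · exact Or.inl rfl
      · exact Or.inr rfl
    · refine Submodule.mem_sup_right ⟨b ⟨k, ⟨i, by omega⟩⟩, ?_⟩
      rw [hb, dif_pos hi]
  · rw [hp, dif_neg]
    simp [z1]
  · rintro ⟨y, hy⟩
    -- The coordinate at position 3 of the long chain vanishes on the range of f⁴ but is 1 on f³w.
    -- Position 3 exists since n - 2 ≥ 4.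
    have h0 : (b.coord ⟨z0, ⟨3, by omega⟩⟩).comp (f ^ 4) = 0 := by
      refine b.ext fun ⟨k, i⟩ => ?_
      rw [LinearMap.comp_apply, hp]
      split_ifs with h
      · rw [Module.Basis.coord_apply, Module.Basis.repr_self, Finsupp.single_apply, if_neg]
        · rfl
        · intro e
          rcases hz k with rfl | rfl
          · simp only [Sigma.mk.injEq, heq_eq_eq, Fin.mk.injEq, true_and] at e
            omega
          · have := congrArg (fun t => (t.1 : ℕ)) e
            simp [z0, z1] at this
      · simp
    have h1 := LinearMap.congr_fun h0 y
    rw [LinearMap.comp_apply, hy, hp, dif_pos (by simp only [g0]; omega)] at h1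
    simp at h1
  · refine b.ext fun ⟨k, i⟩ => ?_
    rw [hp, dif_neg, LinearMap.zero_apply]
    rcases hz k with rfl | rfl
    · simp only [g0]; omega
    · simp only [g1]; omega

end Jordan

theorem AlgIso.symm {A B : Type*} [NonUnitalNonAssocSemiring A] [Module ℂ A]
    [NonUnitalNonAssocSemiring B] [Module ℂ B] (h : AlgIso A B) : AlgIso B A := by
  obtain ⟨f, hf⟩ := h
  obtain ⟨g, hl, hr⟩ := Function.bijective_iff_has_inverse.1 hf
  exact ⟨f.inverse g hl hr, hr.injective, hl.surjective⟩

/-! ### Coefficients in the model algebras, and isomorphisms between them. -/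

namespace Mu

variable {n : ℕ} {a b : ℂ}

theorem hom_ext {M : Type*} [AddCommGroup M] [Module ℂ M] {f g : Mu n a b →ₗ[ℂ] M}
    (h : ∀ i, 1 ≤ i → i ≤ n → f (e n a b i) = g (e n a b i)) : f = g :=
  (basis n a b).ext fun i => by rw [basis_eq_e]; exact h _ (by omega) (by omega)

theorem bilin_ext {M : Type*} [AddCommGroup M] [Module ℂ M]
    {f g : Mu n a b →ₗ[ℂ] Mu n a b →ₗ[ℂ] M}
    (h : ∀ i j, 1 ≤ i → i ≤ n → 1 ≤ j → j ≤ n →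
      f (e n a b i) (e n a b j) = g (e n a b i) (e n a b j)) : f = g :=
  hom_ext fun i hi hi' => hom_ext fun j hj hj' => h i j hi hi' hj hj'

/-- The coefficient of `e_k`. -/
noncomputable def coeff (n : ℕ) (a b : ℂ) (k : ℕ) : Mu n a b →ₗ[ℂ] ℂ :=
  if h : 1 ≤ k ∧ k ≤ n then (basis n a b).coord ⟨k - 1, by omega⟩ else 0

theorem coeff_e {k i : ℕ} (hk : 1 ≤ k) (hk' : k ≤ n) :
    coeff n a b k (e n a b i) = if i = k then 1 else 0 := by
  rw [coeff, dif_pos ⟨hk, hk'⟩, e]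
  split_ifs with h1 h2 h2
  · subst h2; simp
  · rw [Module.Basis.coord_apply, Module.Basis.repr_self, Finsupp.single_apply, if_neg]
    simp only [Fin.mk.injEq]
    omega
  · omega
  · simp

theorem coeff_table {k i j : ℕ} (hk : 1 ≤ k) (hk' : k ≤ n) :
    coeff n a b k (table n a b i j) =
      if i + j + 2 ≤ n then (if i + j = k then 1 else 0)
      else if k = n then
        (if i = 1 ∧ j + 1 = n then 1
        else if i + 1 = n ∧ j = 1 then a
        else if i + 1 = n ∧ j + 1 = n then b else 0)
      else 0 := by
  simp only [table, apply_ite (coeff n a b k), map_smul, coeff_e hk hk', map_zero, smul_eq_mul]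
  split_ifs <;> first | omega | simp

/-- The rank one bilinear form `(x, y) ↦ x_i y_j`. -/
noncomputable def form (n : ℕ) (a b : ℂ) (i j : ℕ) : Mu n a b →ₗ[ℂ] Mu n a b →ₗ[ℂ] ℂ :=
  (LinearMap.mul ℂ ℂ).compl₁₂ (coeff n a b i) (coeff n a b j)

theorem form_apply (i j : ℕ) (x y : Mu n a b) :
    form n a b i j x y = coeff n a b i x * coeff n a b j y := rfl

theorem coeff_mul_eq_form {k : ℕ} (B : Mu n a b →ₗ[ℂ] Mu n a b →ₗ[ℂ] ℂ)
    (h : ∀ i j, 1 ≤ i → i ≤ n → 1 ≤ j → j ≤ n →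
      coeff n a b k (table n a b i j) = B (e n a b i) (e n a b j)) (x y : Mu n a b) :
    coeff n a b k (x * y) = B x y := by
  have : (LinearMap.mul ℂ (Mu n a b)).compr₂ (coeff n a b k) = B :=
    bilin_ext fun i j hi hi' hj hj' => by
      rw [← h i j hi hi' hj hj', ← e_mul_e hi hi' hj hj']
      rfl
  rw [← this]
  rfl

theorem coeff_one_mul (hn : 5 < n) (x y : Mu n a b) : coeff n a b 1 (x * y) = 0 := by
  refine coeff_mul_eq_form 0 (fun i j hi hi' hj hj' => ?_) x y
  rw [coeff_table (by omega) (by omega)]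
  split_ifs <;> first | omega | rfl

theorem coeff_pred_mul (hn : 5 < n) (x y : Mu n a b) : coeff n a b (n - 1) (x * y) = 0 := by
  refine coeff_mul_eq_form 0 (fun i j hi hi' hj hj' => ?_) x y
  rw [coeff_table (by omega) (by omega)]
  split_ifs <;> first | omega | rfl

theorem coeff_two_mul (hn : 5 < n) (x y : Mu n a b) :
    coeff n a b 2 (x * y) = coeff n a b 1 x * coeff n a b 1 y := by
  refine coeff_mul_eq_form (form n a b 1 1) (fun i j hi hi' hj hj' => ?_) x y
  rw [coeff_table (by omega) (by omega), form_apply, coeff_e (by omega) (by omega),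
    coeff_e (by omega) (by omega)]
  split_ifs <;> first | omega | simp

theorem coeff_three_mul (hn : 5 < n) (x y : Mu n a b) :
    coeff n a b 3 (x * y) = coeff n a b 1 x * coeff n a b 2 y +
      coeff n a b 2 x * coeff n a b 1 y := by
  refine coeff_mul_eq_form (form n a b 1 2 + form n a b 2 1)
    (fun i j hi hi' hj hj' => ?_) x y
  simp only [LinearMap.add_apply, form_apply]
  rw [coeff_table (by omega) (by omega)]
  simp only [coeff_e (show 1 ≤ 1 by omega) (show 1 ≤ n by omega),
    coeff_e (show 1 ≤ 2 by omega) (show 2 ≤ n by omega)]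
  split_ifs <;> first | omega | simp

theorem coeff_last_mul (hn : 5 < n) (x y : Mu n a b) :
    coeff n a b n (x * y) = coeff n a b 1 x * coeff n a b (n - 1) y +
      (a * (coeff n a b (n - 1) x * coeff n a b 1 y) +
        b * (coeff n a b (n - 1) x * coeff n a b (n - 1) y)) := by
  refine coeff_mul_eq_form
    (form n a b 1 (n - 1) + (a • form n a b (n - 1) 1 + b • form n a b (n - 1) (n - 1)))
    (fun i j hi hi' hj hj' => ?_) x y
  simp only [LinearMap.add_apply, LinearMap.smul_apply, form_apply, smul_eq_mul]
  rw [coeff_table (by omega) (by omega)]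
  simp only [coeff_e (show 1 ≤ 1 by omega) (show 1 ≤ n by omega),
    coeff_e (show 1 ≤ n - 1 by omega) (show n - 1 ≤ n by omega)]
  split_ifs <;> first | omega | simp

theorem exists_mul_eq_e (hn : 5 < n) {i : ℕ} (hi : 1 ≤ i) (hi' : i ≤ n) (h1 : i ≠ 1)
    (h2 : i ≠ n - 1) : ∃ x y : Mu n a b, x * y = e n a b i := by
  by_cases hin : i = n
  · refine ⟨e n a b 1, e n a b (n - 1), ?_⟩
    rw [e_mul_e (by omega) (by omega) (by omega) (by omega), table, if_neg (by omega),
      if_pos (by omega), hin]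
  · refine ⟨e n a b 1, e n a b (i - 1), ?_⟩
    rw [e_mul_e (by omega) (by omega) (by omega) (by omega), table, if_pos (by omega)]
    congr 1
    omega

variable {a' b' : ℂ}

/-- A functional killing all products sees only e_1 and e_(n-1), since every other basis vector is a
product. -/
theorem coeff_hom_apply (hn : 5 < n) (f : Mu n a b →ₙₐ[ℂ] Mu n a' b') {k : ℕ}
    (hk : ∀ x y : Mu n a' b', coeff n a' b' k (x * y) = 0) (x : Mu n a b) :
    coeff n a' b' k (f x) = coeff n a b 1 x * coeff n a' b' k (f (e n a b 1)) +
      coeff n a b (n - 1) x * coeff n a' b' k (f (e n a b (n - 1))) := by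
  have : coeff n a' b' k ∘ₗ (f : Mu n a b →ₗ[ℂ] Mu n a' b') =
      (coeff n a b 1).smulRight (coeff n a' b' k (f (e n a b 1))) +
        (coeff n a b (n - 1)).smulRight (coeff n a' b' k (f (e n a b (n - 1)))) :=
    hom_ext fun i hi hi' => by
      simp only [LinearMap.comp_apply, LinearMap.add_apply, LinearMap.smulRight_apply, smul_eq_mul]
      rw [coeff_e (by omega) (by omega), coeff_e (by omega) (by omega)]
      change coeff n a' b' k (f (e n a b i)) = _
      split_ifs with h1 h2 h2
      · omega
      · simp [h1]
      · simp [h2]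
      · obtain ⟨y, z, h⟩ := exists_mul_eq_e (a := a) (b := b) hn hi hi' h1 h2
        rw [← h, map_mul, hk]
        simp
  exact LinearMap.congr_fun this x

/-- The equations relating the parameters of isomorphic algebras. -/
theorem AlgIso.exists_params (hn : 5 < n) (h : AlgIso (Mu n a b) (Mu n a' b')) :
    ∃ r s t : ℂ, r ≠ 0 ∧ t ≠ 0 ∧ a' * r + b' * s = a * (r + b' * s) ∧
      b' * t = b * (r + b' * s) := by
  obtain ⟨f, hf⟩ := h
  set X := f (e n a b 1) with hX
  set U := f (e n a b (n - 1)) with hU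
  have eU : e n a b (n - 1) * e n a b (n - 1) = b • (e n a b 1 * e n a b (n - 1)) := by
    rw [e_mul_e (by omega) (by omega) (by omega) (by omega),
      e_mul_e (by omega) (by omega) (by omega) (by omega), table, table, if_neg (by omega),
      if_neg (by omega), if_neg (by omega), if_pos (by omega), if_neg (by omega),
      if_pos (by omega)]
  have eX : e n a b (n - 1) * e n a b 1 = a • (e n a b 1 * e n a b (n - 1)) := by
    rw [e_mul_e (by omega) (by omega) (by omega) (by omega),
      e_mul_e (by omega) (by omega) (by omega) (by omega), table, table, if_neg (by omega),
      if_neg (by omega), if_pos (by omega), if_neg (by omega), if_pos (by omega)]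
  have e3 : e n a b (n - 1) * (e n a b 1 * e n a b (n - 1)) = 0 := by
    rw [e_mul_e (i := 1) (by omega) (by omega) (by omega) (by omega),
      e_mul_table (by omega) (by omega) (by omega) (by omega), if_neg (by omega)]
  have fU : U * U = b • (X * U) := by rw [hX, hU, ← map_mul, ← map_mul, ← map_smul, eU]
  have fX : U * X = a • (X * U) := by rw [hX, hU, ← map_mul, ← map_mul, ← map_smul, eX]
  have f3 : U * (U * U) = 0 := by
    rw [fU, mul_smul_comm, hX, hU, ← map_mul, ← map_mul, e3, map_zero, smul_zero]
  -- The e_3-coefficient of U³ is the cube of the e_1-coefficient of U.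
  have hU1 : coeff n a' b' 1 U = 0 := by
    have := congrArg (coeff n a' b' 3) f3
    rw [coeff_three_mul hn, coeff_one_mul hn, coeff_two_mul hn, map_zero, mul_zero, add_zero] at this
    simpa using this
  have c1 := coeff_hom_apply hn f (coeff_one_mul hn)
  have c2 := coeff_hom_apply hn f (coeff_pred_mul hn)
  simp only [← hX, ← hU, hU1, mul_zero, add_zero] at c1 c2
  have hr : coeff n a' b' 1 X ≠ 0 := fun h0 => by
    obtain ⟨y, hy⟩ := hf.2 (e n a' b' 1)
    have := c1 y
    rw [hy, h0, coeff_e (by omega) (by omega)] at this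
    simp at this
  -- A preimage of e_(n-1) has no e_1-component, so its image gets its e_(n-1)-coefficient from U
  -- alone.
  have ht : coeff n a' b' (n - 1) U ≠ 0 := fun h0 => by
    obtain ⟨y, hy⟩ := hf.2 (e n a' b' (n - 1))
    have k1 := c1 y
    have k2 := c2 y
    rw [hy, coeff_e (by omega) (by omega), if_neg (by omega), eq_comm, mul_eq_zero,
      or_iff_left hr] at k1
    rw [hy, h0, coeff_e (by omega) (by omega), k1] at k2
    simp at k2
  have gX := congrArg (coeff n a' b' n) fX
  have gU := congrArg (coeff n a' b' n) fU
  rw [map_smul, coeff_last_mul hn, coeff_last_mul hn, hU1, smul_eq_mul] at gX gU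
  refine ⟨_, coeff n a' b' (n - 1) X, _, hr, ht, mul_right_cancel₀ ht ?_, mul_right_cancel₀ ht ?_⟩
  · linear_combination gX
  · linear_combination gU

theorem finrank_eq : Module.finrank ℂ (Mu n a b) = n := by
  rw [Module.finrank_eq_card_basis (basis n a b), Fintype.card_fin]

end Mu

/-! ### Generators and relations for the models. -/

section Presentation

variable {A : Type*} [NonUnitalRing A] [Module ℂ A] [IsScalarTower ℂ A A] [SMulCommClass ℂ A A]

/-- `X^(i+1)`. -/
def succPow (X : A) : ℕ → A
  | 0 => X
  | i + 1 => X * succPow X i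

omit [Module ℂ A] [IsScalarTower ℂ A A] [SMulCommClass ℂ A A] in
theorem succPow_mul_succPow (X : A) (i j : ℕ) :
    succPow X i * succPow X j = succPow X (i + j + 1) := by
  induction i with
  | zero => rw [Nat.zero_add]; rfl
  | succ i ih =>
    rw [succPow, mul_assoc, ih, show i + 1 + j + 1 = (i + j + 1) + 1 by omega]
    rfl

theorem succPow_mem_power (X : A) (i : ℕ) : succPow X i ∈ power A (i + 1) := by
  induction i with
  | zero => rw [power_one]; trivial
  | succ i ih =>
    rw [power_add_two]
    exact Submodule.apply_mem_map₂ (LinearMap.mul ℂ A) (m := X) trivial ih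

/-- The images of `e_1, e_2, …` under the homomorphism attached to a pair of generators. -/
noncomputable def genVec (n : ℕ) (X U : A) (i : ℕ) : A :=
  if i + 2 ≤ n then succPow X (i - 1) else if i + 1 = n then U else X * U

/-- Recognition of the algebras `Mu n a b` by generators and relations. -/
theorem algIso_mu_of_relations {n : ℕ} (hn : 5 < n) (hdim : Module.finrank ℂ A = n)
    (h0 : power A (n - 1) = ⊥) {X U : A} {a b : ℂ}
    (hgen : Submodule.span ℂ {X, U} ⊔ power A 2 = ⊤) (hXXU : X * (X * U) = 0)
    (hUX : U * X = a • (X * U)) (hUU : U * U = b • (X * U)) : AlgIso A (Mu n a b) := by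
  -- The relations kill every word of length three that contains U; only powers of X survive beyond
  -- degree two.
  have hXUX : X * U * X = 0 := by rw [mul_assoc, hUX, mul_smul_comm, hXXU, smul_zero]
  have hXUU : X * U * U = 0 := by rw [mul_assoc, hUU, mul_smul_comm, hXXU, smul_zero]
  have hUXU : U * (X * U) = 0 := by rw [← mul_assoc, hUX, smul_mul_assoc, hXUU, smul_zero]
  have hUXX : U * X * X = 0 := by rw [hUX, smul_mul_assoc, hXUX, smul_zero]
  have pU : ∀ i, succPow X (i + 1) * U = 0 := fun i => by
    induction i with
    | zero => exact (mul_assoc X X U).trans hXXU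
    | succ i ih => rw [succPow, mul_assoc, ih, mul_zero]
  have pXU : ∀ i, succPow X i * (X * U) = 0 := fun i => by
    rw [← mul_assoc, show succPow X i * X = succPow X (i + 1) from succPow_mul_succPow X i 0, pU]
  have Up : ∀ i, U * succPow X (i + 1) = 0 := fun i => by
    induction i with
    | zero => exact (mul_assoc U X X).symm.trans hUXX
    | succ i ih =>
      rw [← succPow_mul_succPow X (i + 1) 0, ← mul_assoc, ih, zero_mul]
  have XUp : ∀ i, X * U * succPow X i = 0 := fun i => by
    cases i with
    | zero => exact hXUX
    | succ i => rw [mul_assoc, Up, mul_zero]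
  have pbig : ∀ i, n ≤ i + 2 → succPow X i = 0 := fun i hi => by
    have h1 := power_antitone (by omega) (show n - 1 ≤ i + 1 by omega) (succPow_mem_power X i)
    rwa [h0, Submodule.mem_bot] at h1
  let F : Mu n a b →ₗ[ℂ] A := (Mu.basis n a b).constr ℂ fun i => genVec n X U (i + 1)
  have Fe : ∀ i, 1 ≤ i → i ≤ n → F (Mu.e n a b i) = genVec n X U i := fun i h1 h2 => by
    rw [Mu.e, dif_pos ⟨h1, h2⟩, Module.Basis.constr_basis]
    congr 1
    exact Nat.sub_add_cancel h1
  have Fmul : ∀ x y, F (x * y) = F x * F y := by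
    have : (LinearMap.mul ℂ (Mu n a b)).compr₂ F = (LinearMap.mul ℂ A).compl₁₂ F F := by
      refine Mu.bilin_ext fun i j hi hi' hj hj' => ?_
      change F (Mu.e n a b i * Mu.e n a b j) = F (Mu.e n a b i) * F (Mu.e n a b j)
      rw [Mu.e_mul_e hi hi' hj hj', Fe i hi hi', Fe j hj hj']
      obtain ⟨i, rfl⟩ := Nat.exists_eq_add_of_le' hi
      obtain ⟨j, rfl⟩ := Nat.exists_eq_add_of_le' hj
      have Fn : F (Mu.e n a b n) = X * U := by
        rw [Fe n (by omega) le_rfl, genVec, if_neg (by omega), if_neg (by omega)]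
      rw [genVec, genVec, Mu.table]
      split_ifs with h1 h2 h3 h4 h5 h6 h7 h8 h9 <;> try omega
      · rw [Fe _ (by omega) (by omega), genVec, if_pos h1, succPow_mul_succPow]
        congr 1
        omega
      · rw [Fn, show i + 1 - 1 = 0 by omega]
        rfl
      · rw [map_smul, Fn, show j + 1 - 1 = 0 by omega]
        exact hUX.symm
      · rw [map_smul, Fn, hUU]
      · rw [map_zero, succPow_mul_succPow, pbig _ (by omega)]
      · rw [map_zero, show i + 1 - 1 = i - 1 + 1 by omega, pU]
      · rw [map_zero, pXU]
      · rw [map_zero, show j + 1 - 1 = j - 1 + 1 by omega, Up]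
      · rw [map_zero, hUXU]
      · rw [map_zero, XUp]
      · rw [map_zero, hXUU]
      · rw [map_zero, mul_assoc, hUXU, mul_zero]
    intro x y
    exact LinearMap.congr_fun₂ this x y
  let f : Mu n a b →ₙₐ[ℂ] A :=
    { toFun := F, map_smul' := F.map_smul, map_zero' := F.map_zero, map_add' := F.map_add,
      map_mul' := Fmul }
  -- The image is closed under products and contains the generators; injectivity then follows from
  -- equality of dimensions.
  have hsurj : LinearMap.range F = ⊤ := by
    refine eq_top_of_mul_mem (N := n - 2) (by rwa [show n - 2 + 1 = n - 1 by omega]) hgen ?_ ?_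
    · rw [Submodule.span_le]
      rintro _ (rfl | rfl)
      · refine ⟨Mu.e n a b 1, ?_⟩
        rw [Fe 1 (by omega) (by omega), genVec, if_pos (by omega)]
        rfl
      · refine ⟨Mu.e n a b (n - 1), ?_⟩
        rw [Fe _ (by omega) (by omega), genVec, if_neg (by omega), if_pos (by omega)]
    · rintro _ ⟨x, rfl⟩ _ ⟨y, rfl⟩
      exact ⟨x * y, Fmul x y⟩
  have : FiniteDimensional ℂ A := Module.finite_of_finrank_pos (by omega)
  have : FiniteDimensional ℂ (Mu n a b) := Module.finite_of_finrank_pos (by rw [Mu.finrank_eq]; omega)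
  have hbij : Function.Bijective F := by
    have hs := LinearMap.range_eq_top.1 hsurj
    exact ⟨(LinearMap.injective_iff_surjective_of_finrank_eq_finrank
      (Mu.finrank_eq.trans hdim.symm)).2 hs, hs⟩
  exact AlgIso.symm ⟨f, hbij⟩

end Presentation

/-! ### Extracting and normalising the relations. -/

section Classification

variable {A : Type*} [NonUnitalRing A] [Module ℂ A] [IsScalarTower ℂ A A] [SMulCommClass ℂ A A]

/-- In a naturally graded algebra every `a ∈ A^i` has a homogeneous representative `H i a`, which
is bilinearly compatible with products. -/
theorem IsNaturallyGraded.exists_component (hA : IsNaturallyGraded A) :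
    ∃ H : ℕ → A → A,
      (∀ i, 1 ≤ i → ∀ a ∈ power A i, ∀ b ∈ power A i, H i (a + b) = H i a + H i b) ∧
      (∀ i, 1 ≤ i → ∀ c : ℂ, ∀ a ∈ power A i, H i (c • a) = c • H i a) ∧
      (∀ i, 1 ≤ i → ∀ a ∈ power A i, H i a = 0 ↔ a ∈ power A (i + 1)) ∧
      (∀ i j, 1 ≤ i → 1 ≤ j → ∀ a ∈ power A i, ∀ b ∈ power A j,
        H i a * H j b = H (i + j) (a * b)) ∧
      ∀ T : Submodule ℂ A, (∀ i, 1 ≤ i → ∀ a ∈ power A i, H i a ∈ T) → T = ⊤ := by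
  classical
  obtain ⟨-, g, hg⟩ := hA
  let h : ∀ i : ℕ+, power A i →ₗ[ℂ] A := fun i =>
    (g : Gr A →ₗ[ℂ] A) ∘ₗ DirectSum.lof ℂ ℕ+ (grPiece A) i ∘ₗ grMk A i
  have hh : ∀ i a, h i a = g (DirectSum.of (grPiece A) i (grMk A i a)) := fun i a => rfl
  have hz : ∀ (i : ℕ+) (a : power A i), h i a = 0 ↔ (a : A) ∈ power A ((i : ℕ) + 1) := by
    intro i a
    rw [hh, map_eq_zero_iff g hg.1, map_eq_zero_iff _ (DirectSum.of_injective _)]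
    exact Submodule.Quotient.mk_eq_zero _
  have hm : ∀ (i j : ℕ+) (a : power A i) (b : power A j),
      h i a * h j b = h (i + j) ⟨(a : A) * b, mul_mem_power A i.2 j.2 a.2 b.2⟩ := by
    intro i j a b
    rw [hh, hh, hh, ← map_mul, DirectSum.of_mul_of]
    rfl
  -- The value 0 off A^i is a default that lets H take plain elements of A.
  let H : ℕ → A → A := fun i a =>
    if p : 1 ≤ i ∧ a ∈ power A i then h ⟨i, p.1⟩ ⟨a, p.2⟩ else 0
  have hH : ∀ i (hi : 1 ≤ i) a (ha : a ∈ power A i), H i a = h ⟨i, hi⟩ ⟨a, ha⟩ :=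
    fun i hi a ha => dif_pos ⟨hi, ha⟩
  refine ⟨H, fun i hi a ha b hb => ?_, fun i hi c a ha => ?_, fun i hi a ha => ?_,
    fun i j hi hj a ha b hb => ?_, fun T hT => ?_⟩
  · rw [hH i hi a ha, hH i hi b hb, hH i hi _ (add_mem ha hb), ← map_add]
    rfl
  · rw [hH i hi a ha, hH i hi _ (Submodule.smul_mem _ c ha), ← map_smul]
    rfl
  · rw [hH i hi a ha]
    exact hz ⟨i, hi⟩ ⟨a, ha⟩
  · rw [hH i hi a ha, hH j hj b hb, hH _ (by omega) _ (mul_mem_power A hi hj ha hb)]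
    exact hm ⟨i, hi⟩ ⟨j, hj⟩ ⟨a, ha⟩ ⟨b, hb⟩
  · rw [eq_top_iff]
    intro y _
    obtain ⟨z, rfl⟩ := hg.2 y
    induction z using DirectSum.induction_on with
    | zero => rw [map_zero]; exact zero_mem _
    | of i p =>
      obtain ⟨a, rfl⟩ := Submodule.mkQ_surjective _ p
      have := hT i i.2 a a.2
      rwa [hH i i.2 a a.2] at this
    | add p q hp hq => rw [map_add]; exact add_mem (hp trivial) (hq trivial)

/-- xA has codimension at most 2. Were it strictly inside A², then A² would have codimension at most
1, so x would generate A modulo A², and the one-generator case gives A² = xA, a contradiction. -/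
theorem power_two_eq_range [FiniteDimensional ℂ A] (hA : IsNilpotentAlg A) {x w v : A}
    (hx : x ∉ power A 2)
    (hwv : Submodule.span ℂ {w, v} ⊔ LinearMap.range (LinearMap.mulLeft ℂ x) = ⊤) :
    power A 2 = LinearMap.range (LinearMap.mulLeft ℂ x) := by
  by_contra hne
  have hle : LinearMap.range (LinearMap.mulLeft ℂ x) ≤ power A 2 := by
    rintro _ ⟨b, rfl⟩
    exact mul_mem_power_two x b
  have h1 := Submodule.finrank_lt_finrank_of_lt (lt_of_le_of_ne hle (Ne.symm hne))
  have h2 : power A 2 < ℂ ∙ x ⊔ power A 2 := by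
    refine lt_of_le_of_ne le_sup_right fun h => hx ?_
    rw [h]
    exact Submodule.mem_sup_left (Submodule.mem_span_singleton_self x)
  have h3 := Submodule.finrank_lt_finrank_of_lt h2
  have h4 := Submodule.finrank_add_le_finrank_add_finrank (Submodule.span ℂ {w, v})
    (LinearMap.range (LinearMap.mulLeft ℂ x))
  have h5 : Module.finrank ℂ (Submodule.span ℂ {w, v}) ≤ 2 := by
    classical
    have := finrank_span_finset_le_card (R := ℂ) ({w, v} : Finset A)
    rw [Finset.coe_pair] at this
    exact this.trans Finset.card_le_two
  rw [hwv, finrank_top] at h4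
  have h6 : ℂ ∙ x ⊔ power A 2 = ⊤ :=
    Submodule.eq_top_of_finrank_eq (le_antisymm (Submodule.finrank_le _) (by omega))
  exact hne (power_two_eq_range_of_span_singleton hA h6)

theorem exists_relations {n : ℕ} (hn : 5 < n) (hdim : Module.finrank ℂ A = n)
    (hA : IsNaturallyGraded A) (hC : HasCharacteristicSequence A [n - 2, 2]) :
    power A (n - 1) = ⊥ ∧ ∃ (X U : A) (a b : ℂ), Submodule.span ℂ {X, U} ⊔ power A 2 = ⊤ ∧
      X * (X * U) = 0 ∧ U * X = a • (X * U) ∧ U * U = b • (X * U) := by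
  have : FiniteDimensional ℂ A := Module.finite_of_finrank_pos (by omega)
  obtain ⟨⟨x, hx, hJ⟩, -⟩ := hC
  obtain ⟨w, v, hwv, hv, hw, h0⟩ := hJ.exists_generators hn
  have h2 := power_two_eq_range hA.1 hx hwv
  have hpow := power_eq_range_pow h2
  refine ⟨?_, ?_⟩
  · rw [show n - 1 = n - 2 + 1 by omega, hpow, h0, LinearMap.range_zero]
  obtain ⟨H, hadd, hsmul, hzero, hmul, hspan⟩ := hA.exists_component
  have one : ∀ c : A, c ∈ power A 1 := fun c => by rw [power_one]; trivial
  have m2 : ∀ c : A, x * c ∈ power A 2 := mul_mem_power_two x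
  have m3 : ∀ c : A, x * (x * c) ∈ power A 3 := fun c =>
    mul_mem_power A le_rfl one_le_two (one x) (m2 c)
  have m4 : ∀ c : A, x * (x * (x * c)) ∈ power A 4 := fun c =>
    mul_mem_power A le_rfl (by omega) (one x) (m3 c)
  have e2 : ∀ c, H 1 x * H 1 c = H 2 (x * c) := fun c =>
    hmul 1 1 le_rfl le_rfl x (one x) c (one c)
  have e3 : ∀ c, H 1 x * (H 1 x * H 1 c) = H 3 (x * (x * c)) := fun c => by
    rw [e2, hmul 1 2 le_rfl one_le_two x (one x) _ (m2 c)]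
  have e4 : ∀ c, H 1 x * (H 1 x * (H 1 x * H 1 c)) = H 4 (x * (x * (x * c))) := fun c => by
    rw [e3, hmul 1 3 le_rfl (by omega) x (one x) _ (m3 c)]
  set X := H 1 x
  set W := H 1 w
  set U := H 1 v
  have hXXU : X * (X * U) = 0 := by
    have hv' : x * (x * v) = 0 := hv
    rw [e3, hzero 3 (by omega) _ (m3 v), hv']
    exact zero_mem _
  -- The component of x³w in degree 4 vanishes only if x³w ∈ A⁵ = x⁴A.
  have hXXXW : X * (X * (X * W)) ≠ 0 := by
    rw [e4, Ne, hzero 4 (by omega) _ (m4 w), hpow 4]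
    exact hw
  have dec : ∀ c, ∃ p q : ℂ, H 1 c = p • W + q • U := fun c => by
    obtain ⟨y, hy, r, hr, rfl⟩ := Submodule.mem_sup.1 (hwv ▸ Submodule.mem_top : c ∈ _)
    obtain ⟨p, q, rfl⟩ := Submodule.mem_span_pair.1 hy
    refine ⟨p, q, ?_⟩
    rw [hadd 1 le_rfl _ (one _) _ (one _), hadd 1 le_rfl _ (one _) _ (one _),
      hsmul 1 le_rfl _ _ (one _), hsmul 1 le_rfl _ _ (one _),
      (hzero 1 le_rfl r (one r)).2 (h2 ▸ hr), add_zero]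
  obtain ⟨a, b, hX⟩ : ∃ p q : ℂ, X = p • W + q • U := dec x
  have hX4 : X * (X * (X * X)) = a • (X * (X * (X * W))) := by
    conv_lhs => enter [2, 2, 2]; rw [hX]
    simp only [mul_add, mul_smul_comm, hXXU, smul_zero, add_zero]
  -- If X = bU, then X³ = b·X²U = 0, which contradicts X³W ≠ 0.
  have ha : a ≠ 0 := fun h => by
    rw [h, zero_smul, zero_add] at hX
    apply hXXXW
    have hXX : X * (X * X) = 0 := by
      conv_lhs => enter [2, 2]; rw [hX]
      rw [mul_smul_comm, mul_smul_comm, hXXU, smul_zero]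
    rw [← mul_assoc X X W, ← mul_assoc X (X * X) W, hXX, zero_mul]
  have hX4' : X * (X * (X * X)) ≠ 0 := hX4 ▸ smul_ne_zero ha hXXXW
  have dec' : ∀ c, ∃ p q : ℂ, H 1 c = p • X + q • U := fun c => by
    obtain ⟨p, q, hc⟩ := dec c
    refine ⟨p / a, q - p / a * b, ?_⟩
    rw [hc, hX]
    match_scalars
    · field_simp
    · ring
  -- Since cd = xy for some y, the product of the components is X times the component of y.
  have prod : ∀ c d, ∃ p q : ℂ, H 1 c * H 1 d = p • (X * X) + q • (X * U) := fun c d => by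
    obtain ⟨y, hy⟩ : c * d ∈ LinearMap.range (LinearMap.mulLeft ℂ x) :=
      h2 ▸ mul_mem_power_two c d
    rw [LinearMap.mulLeft_apply] at hy
    obtain ⟨p, q, hp⟩ := dec' y
    refine ⟨p, q, ?_⟩
    rw [hmul 1 1 le_rfl le_rfl c (one c) d (one d), ← hy, ← e2, hp, mul_add, mul_smul_comm,
      mul_smul_comm]
  have prodU : ∀ d, ∃ q : ℂ, U * H 1 d = q • (X * U) := fun d => by
    obtain ⟨p, q, hp⟩ := prod v d
    -- Left multiplication by X² kills U·d and XU, leaving p·X⁴ = 0 and hence p = 0.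
    have hz : X * (X * (U * H 1 d)) = 0 := by
      rw [← mul_assoc X U, ← mul_assoc X (X * U), hXXU, zero_mul]
    have hp' : U * H 1 d = p • (X * X) + q • (X * U) := hp
    rw [hp', mul_add, mul_add, mul_smul_comm, mul_smul_comm, mul_smul_comm, mul_smul_comm, hXXU,
      mul_zero, smul_zero, add_zero, smul_eq_zero, or_iff_left hX4'] at hz
    exact ⟨q, by rw [hp', hz, zero_smul, zero_add]⟩
  obtain ⟨q, hq⟩ := prodU x
  obtain ⟨s, hs⟩ := prodU v
  refine ⟨X, U, q, s, hspan _ fun i hi c hc => ?_, hXXU, hq, hs⟩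
  rcases i with _ | _ | i
  · omega
  · obtain ⟨p, q, h⟩ := dec' c
    exact Submodule.mem_sup_left (Submodule.mem_span_pair.2 ⟨p, q, h.symm⟩)
  -- Components of degree at least two are of the form X·(component), hence lie in A².
  · rw [power_add_two_eq_map h2] at hc
    obtain ⟨d, hd, rfl⟩ := hc
    refine Submodule.mem_sup_right ?_
    rw [LinearMap.mulLeft_apply, show i + 1 + 1 = 1 + (i + 1) by omega,
      ← hmul 1 (i + 1) le_rfl (by omega) x (one x) d hd]
    exact mul_mem_power_two _ _

omit [IsScalarTower ℂ A A] [SMulCommClass ℂ A A] in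
theorem span_pair_sup_eq_top {P : Submodule ℂ A} {X U Y V : A}
    (h : Submodule.span ℂ {X, U} ⊔ P = ⊤) (hX : X ∈ Submodule.span ℂ {Y, V})
    (hU : U ∈ Submodule.span ℂ {Y, V}) : Submodule.span ℂ {Y, V} ⊔ P = ⊤ := by
  rw [eq_top_iff, ← h]
  refine sup_le_sup_right (Submodule.span_le.2 ?_) P
  rintro _ (rfl | rfl)
  exacts [hX, hU]

theorem algIso_of_relations {n : ℕ} (hn : 5 < n) (hdim : Module.finrank ℂ A = n)
    (h0 : power A (n - 1) = ⊥) {X U : A} {a b : ℂ}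
    (hgen : Submodule.span ℂ {X, U} ⊔ power A 2 = ⊤) (hXXU : X * (X * U) = 0)
    (hUX : U * X = a • (X * U)) (hUU : U * U = b • (X * U)) :
    (∃ α : ℂ, AlgIso A (Mu22 n α)) ∨ AlgIso A (Mu23 n) ∨ AlgIso A (Mu24 n) := by
  by_cases hb : b = 0
  · subst hb
    exact Or.inl ⟨a, algIso_mu_of_relations hn hdim h0 hgen hXXU hUX hUU⟩
  by_cases ha : a = 1
  · subst ha
    refine Or.inr (Or.inl (algIso_mu_of_relations (X := X) (U := b⁻¹ • U) hn hdim h0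
      (span_pair_sup_eq_top hgen (Submodule.mem_span_pair.2 ⟨1, 0, by simp⟩)
        (Submodule.mem_span_pair.2 ⟨0, b, by simp [smul_smul, hb]⟩)) ?_ ?_ ?_))
    · simp only [mul_smul_comm, hXXU, smul_zero]
    · simp only [mul_smul_comm, smul_mul_assoc, hUX, one_smul]
    · simp only [mul_smul_comm, smul_mul_assoc, hUU, smul_smul]
      congr 1
      field_simp
  · have ha' : 1 - a ≠ 0 := sub_ne_zero.2 (Ne.symm ha)
    have hUXU : U * (X * U) = 0 := by
      rw [← mul_assoc, hUX, smul_mul_assoc, mul_assoc, hUU, mul_smul_comm, hXXU, smul_zero,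
        smul_zero]
    -- For X' = X - cU and U' = dU, one has U'X' = d(a - cb)XU, X'U' = d(1 - cb)XU and U'U' =
    -- d²b·XU. Thus c = a/b gives U'X' = 0, and db = 1 - a gives U'U' = X'U'; d ≠ 0 needs a ≠ 1.
    refine Or.inr (Or.inr (algIso_mu_of_relations (X := X - (a / b) • U)
      (U := ((1 - a) / b) • U) hn hdim h0
      (span_pair_sup_eq_top hgen (Submodule.mem_span_pair.2 ⟨1, a / (1 - a), ?_⟩)
        (Submodule.mem_span_pair.2 ⟨0, b / (1 - a), ?_⟩)) ?_ ?_ ?_))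
    · match_scalars
      · ring
      · field_simp
        ring
    · rw [zero_smul, zero_add, smul_smul, div_mul_div_comm, mul_comm b, div_self (mul_ne_zero ha' hb),
        one_smul]
    · simp only [mul_smul_comm, smul_mul_assoc, sub_mul, mul_sub, hUU, hXXU, hUXU, smul_zero,
        sub_zero]
    · simp only [mul_smul_comm, smul_mul_assoc, sub_mul, mul_sub, hUX, hUU]
      match_scalars
      field_simp
      ring
    · simp only [mul_smul_comm, smul_mul_assoc, sub_mul, hUU]
      match_scalars
      field_simp

end Classification

end NilAssoc

theorem mainTheorem4 (n : ℕ) (hn : 5 < n) :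
    (∀ (A : Type*) [NonUnitalRing A] [Module ℂ A] [IsScalarTower ℂ A A] [SMulCommClass ℂ A A],
      Module.finrank ℂ A = n → NilAssoc.IsNaturallyGraded A →
      NilAssoc.HasCharacteristicSequence A [n - 2, 2] →
        (∃ α : ℂ, NilAssoc.AlgIso A (NilAssoc.Mu22 n α)) ∨
          NilAssoc.AlgIso A (NilAssoc.Mu23 n) ∨ NilAssoc.AlgIso A (NilAssoc.Mu24 n)) ∧
    (∀ α β : ℂ, α ≠ β → ¬ NilAssoc.AlgIso (NilAssoc.Mu22 n α) (NilAssoc.Mu22 n β)) ∧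
    (∀ α : ℂ, ¬ NilAssoc.AlgIso (NilAssoc.Mu22 n α) (NilAssoc.Mu23 n)) ∧
    (∀ α : ℂ, ¬ NilAssoc.AlgIso (NilAssoc.Mu22 n α) (NilAssoc.Mu24 n)) ∧
    ¬ NilAssoc.AlgIso (NilAssoc.Mu23 n) (NilAssoc.Mu24 n) := by
  refine ⟨?_, fun α β hαβ h => ?_, fun α h => ?_, fun α h => ?_, fun h => ?_⟩
  · intro A _ _ _ _ hdim hA hC
    obtain ⟨h0, X, U, a, b, hgen, hXXU, hUX, hUU⟩ := NilAssoc.exists_relations hn hdim hA hC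
    exact NilAssoc.algIso_of_relations hn hdim h0 hgen hXXU hUX hUU
  all_goals obtain ⟨r, s, t, hr, ht, h1, h2⟩ := NilAssoc.Mu.AlgIso.exists_params hn h
  · exact hαβ (mul_right_cancel₀ hr (by linear_combination -h1))
  · exact ht (by linear_combination h2)
  · exact ht (by linear_combination h2)
  · exact hr (by linear_combination -h1)
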